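/- Let $\mathcal H,\mathcal K$ be complex separable Hilbert spaces, let $H$ be a self-adjoint (possibly unbounded) operator in $\mathcal H$ with spectral measure $E_H$, and let $G$ be a linear operator from $\mathcal H$ to $\mathcal K$ (not assumed closable) which is $H$-bounded, i.e. $\operatorname{Dom}H\subset\operatorname{Dom}G$ and $G(H-z)^{-1}$ is bounded for all $z\in\mathbb C\setminus\mathbb R$. Assume that $G$ is Kato smooth with respect to $H$, i.e. $$\|G\|_{\mathrm{Smooth}(H)}^2:=\sup_{a<b}\frac{\|G\,E_H(a,b)\|^2}{b-a}<\infty ,$$ the supremum being over all bounded open intervals $(a,b)\subset\mathbb R$. For $\varphi\in L^2(\mathbb R)$, $G\varphi(H)$ denotes the bounded operator from $\mathcal H$ to $\mathcal K$ which vanishes on the singular subspace of $H$ and satisfies $(G\varphi(H))u=G(\varphi(H)u)$ for every $u\in\mathcal H$ whose spectral measure $(E_H(\cdot)u,u)$ is absolutely continuous with a bounded compactly supported density (such $u$ are dense in the absolutely continuous subspace of $H$). Let $\{\psi_n\}_{n=1}^\infty$ be an orthonormal sequence in $L^2(\mathbb R)$. Then the bounded operators $G\psi_n(H)$ are well defined,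 and for every $u\in\mathcal H$ $$\sum_{n=1}^\infty\|G\psi_n(H)u\|_{\mathcal K}^2\le\|G\|_{\mathrm{Smooth}(H)}^2\,\|u\|_{\mathcal H}^2 .$$ -/

import Mathlib

open MeasureTheory Filter Topology
open scoped ENNReal NNReal InnerProductSpace

noncomputable section

namespace KatoSmooth

section PVM

/-- A projection-valued measure on the Borel sets of `ℝ` with values in the orthogonal projections
of a complex Hilbert space (it is set to `0` on sets that are not Borel). -/
structure ProjectionMeasure (ℋ : Type*) [NormedAddCommGroup ℋ] [InnerProductSpace ℂ ℋ]
    [CompleteSpace ℋ] where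
  proj : Set ℝ → ℋ →L[ℂ] ℋ
  isStarProjection : ∀ A, MeasurableSet A → IsStarProjection (proj A)
  univ : proj Set.univ = 1
  inter : ∀ A B, MeasurableSet A → MeasurableSet B → proj (A ∩ B) = proj A * proj B
  hasSum_iUnion : ∀ A : ℕ → Set ℝ, (∀ i, MeasurableSet (A i)) →
    Pairwise (Function.onFun Disjoint A) →
      ∀ u : ℋ, HasSum (fun i => proj (A i) u) (proj (⋃ i, A i) u)
  not_measurable : ∀ A, ¬ MeasurableSet A → proj A = 0

variable {ℋ : Type*} [NormedAddCommGroup ℋ] [InnerProductSpace ℂ ℋ] [CompleteSpace ℋ]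

namespace ProjectionMeasure

open scoped Classical in
/-- The projection-valued measure concentrated at the point `0`. -/
def diracZero (ℋ : Type*) [NormedAddCommGroup ℋ] [InnerProductSpace ℂ ℋ]
    [CompleteSpace ℋ] : ProjectionMeasure ℋ where
  proj A := if MeasurableSet A ∧ (0 : ℝ) ∈ A then 1 else 0
  isStarProjection A _ := by
    split_ifs
    · exact IsStarProjection.one _
    · exact IsStarProjection.zero _
  univ := by simp
  inter A B hA hB := by
    by_cases h1 : (0 : ℝ) ∈ A <;> by_cases h2 : (0 : ℝ) ∈ B <;> simp [hA, hB, h1, h2, hA.inter hB]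
  hasSum_iUnion A hA hd u := by
    by_cases h : ∃ i, (0 : ℝ) ∈ A i
    · obtain ⟨i, hi⟩ := h
      have h0 : (0 : ℝ) ∈ ⋃ i, A i := Set.mem_iUnion.2 ⟨i, hi⟩
      have hs := hasSum_single (f := fun j =>
        (if MeasurableSet (A j) ∧ (0 : ℝ) ∈ A j then (1 : ℋ →L[ℂ] ℋ) else 0) u) i (by
          intro j hj
          have : (0 : ℝ) ∉ A j := fun hj' => Set.disjoint_left.1 (hd hj) hj' hi
          simp [this])
      simpa [hA i, hi, h0, MeasurableSet.iUnion hA] using hs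
    · have h' : ∀ i, (0 : ℝ) ∉ A i := fun i hi => h ⟨i, hi⟩
      simp [h', hasSum_zero]
  not_measurable A hA := by simp [hA]

variable (E : ProjectionMeasure ℋ)

theorem proj_empty : E.proj ∅ = 0 := by
  ext u
  have h := (E.hasSum_iUnion (fun _ => ∅) (fun _ => MeasurableSet.empty)
    (fun _ _ _ => disjoint_bot_left) u).summable
  simpa using h.tendsto_atTop_zero.limUnder_eq.symm.trans tendsto_const_nhds.limUnder_eq |>.symm

theorem re_inner_proj {A : Set ℝ} (hA : MeasurableSet A) (u : ℋ) :
    (⟪u, E.proj A u⟫_ℂ).re = ‖E.proj A u‖ ^ 2 := by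
  have hp := E.isStarProjection A hA
  have h1 : E.proj A (E.proj A u) = E.proj A u := by
    have := congrArg (fun T : ℋ →L[ℂ] ℋ => T u) hp.isIdempotentElem.eq
    simpa using this
  have h2 : ⟪E.proj A u, E.proj A u⟫_ℂ = ⟪u, E.proj A (E.proj A u)⟫_ℂ :=
    (ContinuousLinearMap.isSelfAdjoint_iff_isSymmetric.1 hp.isSelfAdjoint) u (E.proj A u)
  rw [h1] at h2
  rw [← h2, inner_self_eq_norm_sq_to_K]
  norm_cast

/-- The scalar spectral measure `μ_u(A) = (E(A)u, u) = ‖E(A)u‖²`. -/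
def scalarMeasure (u : ℋ) : Measure ℝ :=
  Measure.ofMeasurable (fun A _ => ENNReal.ofReal (‖E.proj A u‖ ^ 2))
    (by simp [E.proj_empty])
    (by
      intro A hA hd
      have h := E.hasSum_iUnion A hA hd u
      have h' := ((h.mapL (innerSL ℂ u)).mapL Complex.reCLM)
      simp only [innerSL_apply_apply, Complex.reCLM_apply] at h'
      simp only [E.re_inner_proj (hA _), E.re_inner_proj (MeasurableSet.iUnion hA)] at h'
      rw [← h'.tsum_eq, ENNReal.ofReal_tsum_of_nonneg (fun _ => by positivity) h'.summable])

/-- The operator `s(H) = ∑ c • E(s⁻¹{c})` for a simple Borel function `s`. -/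
def simpleIntegral (s : SimpleFunc ℝ ℂ) : ℋ →L[ℂ] ℋ :=
  ∑ c ∈ s.range, c • E.proj (s ⁻¹' {c})

/-- `E.HasIntegral φ u w` says that `φ ∈ L²(μ_u)`, i.e. that `u` is in the domain of the operator
`∫ φ dE`, and that `w = (∫ φ dE) u`: whenever simple functions `s n` tend to `φ` in `L²(μ_u)`, the
vectors `s n (H) u` tend to `w`. -/
def HasIntegral (φ : ℝ → ℂ) (u w : ℋ) : Prop :=
  MemLp φ 2 (E.scalarMeasure u) ∧
    ∀ s : ℕ → SimpleFunc ℝ ℂ,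
      Tendsto (fun n => eLpNorm (fun x => φ x - s n x) 2 (E.scalarMeasure u)) atTop (𝓝 0) →
        Tendsto (fun n => E.simpleIntegral (s n) u) atTop (𝓝 w)

/-- `H = ∫ λ dE(λ)`: the domain of `H` consists of the `u` with `∫ λ² dμ_u(λ) < ∞`, and
`(Hu, u) = ∫ λ dμ_u(λ)` for these `u` (by polarization this determines `H` on its domain). -/
def IsSpectralMeasureOf (H : ℋ →ₗ.[ℂ] ℋ) : Prop :=
  (∀ u : ℋ, u ∈ H.domain ↔ Integrable (fun x : ℝ => x ^ 2) (E.scalarMeasure u)) ∧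
    ∀ u : H.domain, ⟪(u : ℋ), H u⟫_ℂ = ((∫ x, x ∂E.scalarMeasure (u : ℋ) : ℝ) : ℂ)

end ProjectionMeasure

open scoped Classical in
/-- The spectral measure `E_H` of a self-adjoint operator `H`: the unique projection-valued
measure with `H = ∫ λ dE_H(λ)`. (By the spectral theorem it exists for every self-adjoint `H`; the
value `diracZero` is only taken for operators which have no spectral measure.) -/
def spectralMeasure (H : ℋ →ₗ.[ℂ] ℋ) : ProjectionMeasure ℋ :=
  if h : ∃ E : ProjectionMeasure ℋ, E.IsSpectralMeasureOf H then h.choose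
  else ProjectionMeasure.diracZero ℋ

/-- The set `L^∞_comp(H)`: the vectors `u` whose spectral measure `μ_u` is absolutely continuous
with a bounded and compactly supported density. -/
def IsLinftyComp (H : ℋ →ₗ.[ℂ] ℋ) (u : ℋ) : Prop :=
  ∃ ρ : ℝ → ℝ≥0, Measurable ρ ∧ HasCompactSupport ρ ∧ (∃ M : ℝ≥0, ∀ x, ρ x ≤ M) ∧
    (spectralMeasure H).scalarMeasure u = volume.withDensity (fun x => (ρ x : ℝ≥0∞))

/-- `u` is in the singular subspace of `H`: the measure `μ_u` is singular with respect to Lebesgue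
measure. -/
def IsSingularVector (H : ℋ →ₗ.[ℂ] ℋ) (u : ℋ) : Prop :=
  (spectralMeasure H).scalarMeasure u ⟂ₘ volume

end PVM

variable {ℋ 𝒦 : Type*} [NormedAddCommGroup ℋ] [InnerProductSpace ℂ ℋ] [CompleteSpace ℋ]
  [NormedAddCommGroup 𝒦] [InnerProductSpace ℂ 𝒦] [CompleteSpace 𝒦]

/-- `G` is `H`-bounded: `Dom H ⊆ Dom G` and `G (H - z)⁻¹` is bounded for all non-real `z`, that is
`‖G u‖ ≤ C ‖(H - z) u‖` on `Dom H`. -/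
def IsRelBounded (H : ℋ →ₗ.[ℂ] ℋ) (G : ℋ →ₗ.[ℂ] 𝒦) : Prop :=
  ∃ hdom : H.domain ≤ G.domain, ∀ z : ℂ, z.im ≠ 0 →
    ∃ C : ℝ, ∀ u : H.domain, ‖G ⟨u, hdom u.2⟩‖ ≤ C * ‖H u - z • (u : ℋ)‖

open scoped Classical in
/-- The norm `‖G v‖` in `[0, ∞]`, equal to `∞` if `v` is not in the domain of `G`. -/
def enormApply (G : ℋ →ₗ.[ℂ] 𝒦) (v : ℋ) : ℝ≥0∞ :=
  if h : v ∈ G.domain then ‖G ⟨v, h⟩‖ₑ else ∞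

/-- The operator norm of `G E_H(A)` in `[0, ∞]`. -/
def projNorm (H : ℋ →ₗ.[ℂ] ℋ) (G : ℋ →ₗ.[ℂ] 𝒦) (A : Set ℝ) : ℝ≥0∞ :=
  ⨆ (u : ℋ) (_ : ‖u‖ ≤ 1), enormApply G ((spectralMeasure H).proj A u)

/-- The supremum over all bounded open intervals `(a, b)` of `‖G E_H(a, b)‖² / (b - a)`. -/
def smoothConst (H : ℋ →ₗ.[ℂ] ℋ) (G : ℋ →ₗ.[ℂ] 𝒦) : ℝ≥0∞ :=
  ⨆ (a : ℝ) (b : ℝ) (_ : a < b), projNorm H G (Set.Ioo a b) ^ 2 / ENNReal.ofReal (b - a)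

/-- `G ∈ Smooth(H)`: the `H`-bounded operator `G` is Kato smooth with respect to `H`. -/
def IsKatoSmooth (H : ℋ →ₗ.[ℂ] ℋ) (G : ℋ →ₗ.[ℂ] 𝒦) : Prop :=
  IsRelBounded H G ∧ smoothConst H G < ∞

/-- The norm `‖G‖_{Smooth(H)}`. -/
def smoothNorm (H : ℋ →ₗ.[ℂ] ℋ) (G : ℋ →ₗ.[ℂ] 𝒦) : ℝ :=
  Real.sqrt (smoothConst H G).toReal

/-- The bounded operator `T` is the operator `G φ(H)`: it vanishes on the singular subspace of `H`,
and it is given by `u ↦ G (φ(H) u)` on `L^∞_comp(H)`, which is dense in the absolutely continuous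
subspace of `H`. In particular `T` is uniquely determined by `G`, `H` and `φ`. -/
def IsMulFun (H : ℋ →ₗ.[ℂ] ℋ) (G : ℋ →ₗ.[ℂ] 𝒦) (φ : ℝ → ℂ) (T : ℋ →L[ℂ] 𝒦) : Prop :=
  (∀ u, IsSingularVector H u → T u = 0) ∧
    ∀ u, IsLinftyComp H u →
      ∃ w : G.domain, (spectralMeasure H).HasIntegral φ u w ∧ T u = G w

open scoped Classical in
/-- The bounded operator `G φ(H)` (with the value `0` if `G φ(H)` has no bounded extension). -/
def mulFun (H : ℋ →ₗ.[ℂ] ℋ) (G : ℋ →ₗ.[ℂ] 𝒦) (φ : ℝ → ℂ) : ℋ →L[ℂ] 𝒦 :=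
  if h : ∃ T : ℋ →L[ℂ] 𝒦, IsMulFun H G φ T then h.choose else 0

end KatoSmooth

end

/-! For fixed `u`, the map `φ ↦ G φ(H) u` from L²(ℝ) to `𝒦` is Hilbert–Schmidt with norm at most
`‖G‖ ‖u‖`, where `‖G‖` is the smoothness norm; summing over an orthonormal sequence is then Bessel's
inequality.

The source of the bound is duality: smoothness says that the spectral measure of `(G E(-R, R))^* v`
is at most `‖G‖² ‖v‖²` times Lebesgue measure (`scalarMeasure_adjoint_truncOp_le`). This upgrades
the hypothesis from intervals to Borel sets: `‖G E(-R, R) E(A) u‖² ≤ ‖G‖² |A| ‖E(A) u‖²`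
(`norm_truncOp_proj_le`). If `φ` is constant on disjoint cells `A_i` of finite measure and zero
elsewhere, then `G E(-R, R) φ(H) u = ∑ ⟪h_i, φ⟫ z_i` with `h_i = 1_{A_i} / |A_i|` and `z_i = G E(-R,
R) E(A_i) u`. The `h_i` are orthogonal, so the squared Hilbert–Schmidt norm is `∑ ‖z_i‖² / |A_i| ≤
‖G‖² ∑ ‖E(A_i) u‖² ≤ ‖G‖² ‖u‖²`, null cells contributing nothing (`exists_hilbertSchmidt_average`).
Approximation by simple functions with common cells, and the splitting of `u` into a singular vector
and a limit of `L^∞_comp` vectors, give the general case.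

The same duality bounds `G E(-R, R) s(H)` in operator norm by `‖G‖ ‖s‖_{L²}` for simple `s`, whence
`G φ(H)` exists as a norm limit. Closability of `G` is never needed, because only the bounded
operators `G E(-R, R)` are passed to the limit. -/

namespace KatoSmooth

/-! ### Bessel inequalities for finite-rank maps -/

/-- The Pythagorean theorem for finite sums of pairwise orthogonal vectors. -/
theorem norm_sum_sq_of_pairwise_inner_eq_zero {V ι : Type*} [NormedAddCommGroup V]
    [InnerProductSpace ℂ V] (s : Finset ι) (f : ι → V)
    (h : ∀ i ∈ s, ∀ j ∈ s, i ≠ j → ⟪f i, f j⟫_ℂ = 0) :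
    ‖∑ i ∈ s, f i‖ ^ 2 = ∑ i ∈ s, ‖f i‖ ^ 2 := by
  classical
  induction s using Finset.induction_on with
  | empty => simp
  | insert a s ha ih =>
    rw [Finset.sum_insert ha, Finset.sum_insert ha, ← ih fun i hi j hj =>
      h i (Finset.mem_insert_of_mem hi) j (Finset.mem_insert_of_mem hj)]
    have h0 : ⟪f a, ∑ i ∈ s, f i⟫_ℂ = 0 := by
      rw [inner_sum]
      refine Finset.sum_eq_zero fun i hi => h a (Finset.mem_insert_self _ _) i
        (Finset.mem_insert_of_mem hi) ?_
      rintro rfl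
      exact ha hi
    simp [sq, norm_add_sq_eq_norm_sq_add_norm_sq_of_inner_eq_zero _ _ h0]

/-- Bessel's inequality in Hilbert–Schmidt form. -/
theorem sum_norm_sum_inner_smul_sq_le {V W ι : Type*} [NormedAddCommGroup V]
    [InnerProductSpace ℂ V] [NormedAddCommGroup W] [InnerProductSpace ℂ W] {κ : Type*}
    (s : Finset ι) (h : ι → V) (hh : ∀ i ∈ s, ∀ j ∈ s, i ≠ j → ⟪h i, h j⟫_ℂ = 0) (z : ι → W)
    (ψ : κ → V) (hψ : Orthonormal ℂ ψ) (t : Finset κ) :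
    ∑ n ∈ t, ‖∑ i ∈ s, ⟪h i, ψ n⟫_ℂ • z i‖ ^ 2 ≤ ∑ i ∈ s, ‖h i‖ ^ 2 * ‖z i‖ ^ 2 := by
  classical
  -- The span of the `z i` is finite-dimensional, so it has an orthonormal basis even though `W`
  -- need not be complete. Expanding in it reduces the claim to the scalar Bessel inequality, one
  -- basis vector at a time.
  let S : Submodule ℂ W := Submodule.span ℂ (s.image z : Set W)
  have hzS : ∀ i ∈ s, z i ∈ S := fun i hi =>
    Submodule.subset_span (by simpa using ⟨i, hi, rfl⟩)
  let y : ι → S := fun i => if hi : i ∈ s then ⟨z i, hzS i hi⟩ else 0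
  have hy : ∀ i ∈ s, (y i : W) = z i := fun i hi => by simp [y, hi]
  let b := stdOrthonormalBasis ℂ S
  have hsum : ∀ n, ‖∑ i ∈ s, ⟪h i, ψ n⟫_ℂ • z i‖ ^ 2 =
      ∑ j, ‖⟪ψ n, ∑ i ∈ s, ⟪y i, b j⟫_ℂ • h i⟫_ℂ‖ ^ 2 := by
    intro n
    have h1 : ∑ i ∈ s, ⟪h i, ψ n⟫_ℂ • z i = ((∑ i ∈ s, ⟪h i, ψ n⟫_ℂ • y i : S) : W) := by
      push_cast
      exact Finset.sum_congr rfl fun i hi => by rw [hy i hi]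
    rw [h1, ← Submodule.coe_norm, ← b.sum_sq_norm_inner_left]
    refine Finset.sum_congr rfl fun j _ => ?_
    congr 1
    simp only [sum_inner, inner_sum, inner_smul_left, inner_smul_right, inner_conj_symm]
    congr 1
    exact Finset.sum_congr rfl fun i _ => mul_comm _ _
  calc ∑ n ∈ t, ‖∑ i ∈ s, ⟪h i, ψ n⟫_ℂ • z i‖ ^ 2
      = ∑ j, ∑ n ∈ t, ‖⟪ψ n, ∑ i ∈ s, ⟪y i, b j⟫_ℂ • h i⟫_ℂ‖ ^ 2 := by
        rw [Finset.sum_comm]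
        exact Finset.sum_congr rfl fun n _ => hsum n
    _ ≤ ∑ j, ‖∑ i ∈ s, ⟪y i, b j⟫_ℂ • h i‖ ^ 2 :=
        Finset.sum_le_sum fun j _ => hψ.sum_inner_products_le _
    _ = ∑ j, ∑ i ∈ s, ‖⟪y i, b j⟫_ℂ‖ ^ 2 * ‖h i‖ ^ 2 := by
        refine Finset.sum_congr rfl fun j _ => ?_
        rw [norm_sum_sq_of_pairwise_inner_eq_zero]
        · simp [norm_smul, mul_pow]
        · intro i hi k hk hik
          simp [hh i hi k hk hik]
    _ = ∑ i ∈ s, ‖h i‖ ^ 2 * ‖z i‖ ^ 2 := by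
        rw [Finset.sum_comm]
        refine Finset.sum_congr rfl fun i hi => ?_
        rw [← Finset.sum_mul, b.sum_sq_norm_inner_left, mul_comm, ← hy i hi, Submodule.coe_norm]

theorem norm_sum_inner_smul_sq_le {V W ι : Type*} [NormedAddCommGroup V]
    [InnerProductSpace ℂ V] [NormedAddCommGroup W] [InnerProductSpace ℂ W]
    (s : Finset ι) (h : ι → V) (hh : ∀ i ∈ s, ∀ j ∈ s, i ≠ j → ⟪h i, h j⟫_ℂ = 0) (z : ι → W)
    (φ : V) :
    ‖∑ i ∈ s, ⟪h i, φ⟫_ℂ • z i‖ ^ 2 ≤ (∑ i ∈ s, ‖h i‖ ^ 2 * ‖z i‖ ^ 2) * ‖φ‖ ^ 2 := by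
  rcases eq_or_ne φ 0 with rfl | hφ
  · simp
  have hn : ‖φ‖ ≠ 0 := norm_ne_zero_iff.2 hφ
  -- The one-element orthonormal family `φ / ‖φ‖` turns the sum over the family into a bound on a
  -- single vector.
  have ho : Orthonormal ℂ (fun _ : Unit => (((‖φ‖⁻¹ : ℝ) : ℂ)) • φ) :=
    ⟨fun _ => by simp [norm_smul, hn], fun i j hij => absurd (Subsingleton.elim i j) hij⟩
  have key := sum_norm_sum_inner_smul_sq_le s h hh z _ ho Finset.univ
  have e : ∑ i ∈ s, ⟪h i, (((‖φ‖⁻¹ : ℝ) : ℂ)) • φ⟫_ℂ • z i =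
      (((‖φ‖⁻¹ : ℝ) : ℂ)) • ∑ i ∈ s, ⟪h i, φ⟫_ℂ • z i := by
    simp [mul_smul, Finset.smul_sum]
  simp only [Finset.univ_unique, Finset.sum_singleton, e, norm_smul, mul_pow] at key
  have hp : 0 < ‖φ‖ ^ 2 := by positivity
  rw [Complex.norm_real, Real.norm_eq_abs, abs_of_nonneg (by positivity), inv_pow,
    inv_mul_le_iff₀ hp] at key
  rwa [mul_comm]

/-! ### Projection-valued measures and simple functions of `H` -/

namespace ProjectionMeasure

variable {ℋ : Type*} [NormedAddCommGroup ℋ] [InnerProductSpace ℂ ℋ] [CompleteSpace ℋ]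
  (E : ProjectionMeasure ℋ)

theorem proj_union {A B : Set ℝ} (hA : MeasurableSet A) (hB : MeasurableSet B)
    (hd : Disjoint A B) : E.proj (A ∪ B) = E.proj A + E.proj B := by
  ext u
  -- Countable additivity is applied to the sequence `A, B, ∅, ∅, …`.
  have h := E.hasSum_iUnion (fun n => n.casesOn A fun m => m.casesOn B fun _ => ∅)
    (by rintro (_ | _ | i) <;> simp [hA, hB])
    (by rintro (_ | _ | i) (_ | _ | j) hij <;> simp [Function.onFun, hd, hd.symm] at hij ⊢) u
  have hU : (⋃ n : ℕ, (n.casesOn A fun m => m.casesOn B fun _ => ∅ : Set ℝ)) = A ∪ B := by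
    ext x
    simp only [Set.mem_iUnion, Set.mem_union]
    constructor
    · rintro ⟨_ | _ | i, hi⟩
      · exact Or.inl hi
      · exact Or.inr hi
      · exact hi.elim
    · rintro (hx | hx)
      · exact ⟨0, hx⟩
      · exact ⟨1, hx⟩
  rw [hU] at h
  have h2 := hasSum_sum_of_ne_finset_zero (L := .unconditional ℕ) (s := Finset.range 2) (f := fun i =>
    E.proj ((fun n : ℕ => (n.casesOn A fun m => m.casesOn B fun _ => ∅ : Set ℝ)) i) u) (by
      rintro (_ | _ | i) hi
      · simp at hi
      · simp at hi
      · simp [E.proj_empty])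
  simpa [Finset.sum_range_succ] using h.unique h2

theorem proj_proj {A B : Set ℝ} (hA : MeasurableSet A) (hB : MeasurableSet B) (u : ℋ) :
    E.proj A (E.proj B u) = E.proj (A ∩ B) u := by
  rw [E.inter A B hA hB, mul_apply_eq_comp]

theorem inner_proj_left {A : Set ℝ} (hA : MeasurableSet A) (u v : ℋ) :
    ⟪E.proj A u, v⟫_ℂ = ⟪u, E.proj A v⟫_ℂ :=
  (ContinuousLinearMap.isSelfAdjoint_iff_isSymmetric.1
    (E.isStarProjection A hA).isSelfAdjoint) u v

theorem scalarMeasure_apply (u : ℋ) {A : Set ℝ} (hA : MeasurableSet A) :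
    E.scalarMeasure u A = ‖E.proj A u‖ₑ ^ 2 := by
  rw [scalarMeasure, Measure.ofMeasurable_apply A hA, ENNReal.ofReal_pow (norm_nonneg _),
    ofReal_norm]

theorem proj_add_proj_compl {A : Set ℝ} (hA : MeasurableSet A) (u : ℋ) :
    E.proj A u + E.proj Aᶜ u = u := by
  rw [← add_apply, ← E.proj_union hA hA.compl disjoint_compl_right,
    Set.union_compl_self, E.univ, one_apply_eq_self]

theorem proj_apply_eq_self {A : Set ℝ} (hA : MeasurableSet A) {u : ℋ}
    (h : E.scalarMeasure u Aᶜ = 0) : E.proj A u = u := by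
  have h0 : E.proj Aᶜ u = 0 := by simpa [E.scalarMeasure_apply u hA.compl] using h
  simpa [h0] using E.proj_add_proj_compl hA u

theorem scalarMeasure_univ (u : ℋ) : E.scalarMeasure u Set.univ = ‖u‖ₑ ^ 2 := by
  simp [E.scalarMeasure_apply u MeasurableSet.univ, E.univ]

instance isFiniteMeasure_scalarMeasure (u : ℋ) : IsFiniteMeasure (E.scalarMeasure u) :=
  ⟨by simp [E.scalarMeasure_univ]⟩

theorem scalarMeasure_proj {A : Set ℝ} (hA : MeasurableSet A) (u : ℋ) :
    E.scalarMeasure (E.proj A u) = (E.scalarMeasure u).restrict A := by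
  ext B hB
  rw [Measure.restrict_apply hB, E.scalarMeasure_apply _ hB,
    E.scalarMeasure_apply _ (hB.inter hA), E.proj_proj hB hA]

theorem norm_proj_apply_le {A : Set ℝ} (hA : MeasurableSet A) (u : ℋ) : ‖E.proj A u‖ ≤ ‖u‖ := by
  have h : E.scalarMeasure u A ≤ E.scalarMeasure u Set.univ := measure_mono (Set.subset_univ A)
  rw [E.scalarMeasure_univ, E.scalarMeasure_apply _ hA, ENNReal.pow_le_pow_left_iff two_ne_zero]
    at h
  simpa [enorm_le_iff_norm_le] using h

/-- Continuity of `E` from below along an increasing sequence of Borel sets. -/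
theorem tendsto_proj_iUnion {A : ℕ → Set ℝ} (hA : ∀ n, MeasurableSet (A n)) (hm : Monotone A)
    (u : ℋ) : Tendsto (fun n => E.proj (A n) u) atTop (𝓝 (E.proj (⋃ n, A n) u)) := by
  have hU := MeasurableSet.iUnion hA
  have hdiff : ∀ n, E.proj (⋃ n, A n) u - E.proj (A n) u = E.proj ((⋃ n, A n) \ A n) u := by
    intro n
    rw [sub_eq_iff_eq_add, ← add_apply,
      ← E.proj_union (hU.diff (hA n)) (hA n) Set.disjoint_sdiff_left,
      Set.sdiff_union_of_subset (Set.subset_iUnion A n)]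
  have h0 : Tendsto (fun n => E.scalarMeasure u ((⋃ n, A n) \ A n)) atTop (𝓝 0) := by
    have := tendsto_measure_iInter_atTop (μ := E.scalarMeasure u)
      (s := fun n => (⋃ n, A n) \ A n) (fun n => (hU.diff (hA n)).nullMeasurableSet)
      (fun i j hij => Set.sdiff_subset_sdiff_right (hm hij)) ⟨0, measure_ne_top _ _⟩
    rwa [← Set.sdiff_iUnion, Set.sdiff_self, measure_empty] at this
  rw [tendsto_iff_norm_sub_tendsto_zero]
  have h1 : Tendsto (fun n => ‖E.proj (⋃ n, A n) u - E.proj (A n) u‖ₑ ^ 2) atTop (𝓝 0) := by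
    refine h0.congr fun n => ?_
    rw [hdiff, E.scalarMeasure_apply u (hU.diff (hA n))]
  have h2 := (ENNReal.tendsto_toReal ENNReal.zero_ne_top).comp h1
  have h3 := (Real.continuous_sqrt.tendsto _).comp h2
  simpa [Function.comp_def, Real.sqrt_sq, norm_sub_rev] using h3

section SimpleIntegral

variable {β : Type*}

/-- Over the zero measure every set has finite measure and every simple function is integrable, so
the general theory of `setToSimpleFunc` yields the algebra of `simpleIntegral` without side
conditions. -/
theorem finMeasAdditive_proj : FinMeasAdditive (0 : Measure ℝ)
    fun A => (ContinuousLinearMap.id ℂ ℂ).smulRight (E.proj A) |>.restrictScalars ℝ := by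
  intro A B hA hB _ _ hd
  ext c u
  simp [E.proj_union hA hB hd]

theorem simpleIntegral_eq_setToSimpleFunc (s : SimpleFunc ℝ ℂ) :
    E.simpleIntegral s = s.setToSimpleFunc
      fun A => (ContinuousLinearMap.id ℂ ℂ).smulRight (E.proj A) |>.restrictScalars ℝ := by
  simp [simpleIntegral, SimpleFunc.setToSimpleFunc]

theorem simpleIntegral_sub (s t : SimpleFunc ℝ ℂ) :
    E.simpleIntegral (s - t) = E.simpleIntegral s - E.simpleIntegral t := by
  simp only [simpleIntegral_eq_setToSimpleFunc]
  exact SimpleFunc.setToSimpleFunc_sub _ E.finMeasAdditive_proj integrable_zero_measure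
    integrable_zero_measure

theorem simpleIntegral_map {F : Type*} [NormedAddCommGroup F] (t : SimpleFunc ℝ F) {g : F → ℂ}
    (hg : g 0 = 0) :
    E.simpleIntegral (t.map g) = ∑ b ∈ t.range, g b • E.proj (t ⁻¹' {b}) := by
  rw [simpleIntegral_eq_setToSimpleFunc,
    SimpleFunc.map_setToSimpleFunc _ E.finMeasAdditive_proj integrable_zero_measure hg]
  simp

theorem adjoint_simpleIntegral (s : SimpleFunc ℝ ℂ) :
    (E.simpleIntegral s).adjoint = E.simpleIntegral (s.map (starRingEnd ℂ)) := by
  rw [E.simpleIntegral_map s (map_zero _), simpleIntegral, map_sum]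
  refine Finset.sum_congr rfl fun c _ => ?_
  rw [map_smulₛₗ]
  congr 1
  exact (E.isStarProjection _ (s.measurableSet_fiber c)).isSelfAdjoint

theorem proj_simpleIntegral_comm {A : Set ℝ} (hA : MeasurableSet A) (s : SimpleFunc ℝ ℂ) (u : ℋ) :
    E.proj A (E.simpleIntegral s u) = E.simpleIntegral s (E.proj A u) := by
  simp only [simpleIntegral, sum_apply, map_sum,
    smul_apply, map_smul]
  refine Finset.sum_congr rfl fun c _ => ?_
  rw [E.proj_proj hA (s.measurableSet_fiber c), E.proj_proj (s.measurableSet_fiber c) hA,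
    Set.inter_comm]

theorem proj_simpleIntegral_of_support_subset {A : Set ℝ} (hA : MeasurableSet A)
    (s : SimpleFunc ℝ ℂ) (hs : Function.support s ⊆ A) (u : ℋ) :
    E.proj A (E.simpleIntegral s u) = E.simpleIntegral s u := by
  simp only [simpleIntegral, sum_apply, map_sum,
    smul_apply, map_smul]
  refine Finset.sum_congr rfl fun c _ => ?_
  rcases eq_or_ne c 0 with rfl | hc
  · simp
  rw [E.proj_proj hA (s.measurableSet_fiber c), Set.inter_eq_right.2]
  intro x hx
  refine hs ?_
  rw [Function.mem_support, show s x = c from hx]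
  exact hc

/-- `‖s(H) u‖` is the norm of `s` in `L²(μ_u)`. -/
theorem enorm_simpleIntegral (s : SimpleFunc ℝ ℂ) (u : ℋ) :
    ‖E.simpleIntegral s u‖ₑ = eLpNorm s 2 (E.scalarMeasure u) := by
  have h1 : ‖E.simpleIntegral s u‖ ^ 2 =
      ∑ c ∈ s.range, ‖c‖ ^ 2 * ‖E.proj (s ⁻¹' {c}) u‖ ^ 2 := by
    simp only [simpleIntegral, sum_apply, smul_apply]
    rw [norm_sum_sq_of_pairwise_inner_eq_zero]
    · simp [norm_smul, mul_pow]
    · intro c _ d _ hcd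
      rw [inner_smul_left, inner_smul_right, E.inner_proj_left (s.measurableSet_fiber c),
        E.proj_proj (s.measurableSet_fiber c) (s.measurableSet_fiber d),
        ((Set.disjoint_singleton.2 hcd).preimage s).inter_eq, E.proj_empty]
      simp
  have h2 : ‖E.simpleIntegral s u‖ₑ ^ 2 = ∫⁻ x, ‖s x‖ₑ ^ 2 ∂E.scalarMeasure u := by
    have h3 : ∫⁻ x, ‖s x‖ₑ ^ 2 ∂E.scalarMeasure u =
        (s.map fun c => ‖c‖ₑ ^ 2).lintegral (E.scalarMeasure u) := by
      rw [← SimpleFunc.lintegral_eq_lintegral]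
      simp
    rw [h3, SimpleFunc.map_lintegral, ← ofReal_norm, ← ENNReal.ofReal_pow (norm_nonneg _), h1,
      ENNReal.ofReal_sum_of_nonneg fun _ _ => by positivity]
    refine Finset.sum_congr rfl fun c _ => ?_
    rw [E.scalarMeasure_apply u (s.measurableSet_fiber c), ENNReal.ofReal_mul (by positivity),
      ENNReal.ofReal_pow (norm_nonneg _), ENNReal.ofReal_pow (norm_nonneg _), ofReal_norm,
      ofReal_norm]
  have h4 := eLpNorm_nnreal_pow_eq_lintegral (f := s) (μ := E.scalarMeasure u) (p := 2) two_ne_zero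
  have h5 : ∀ x : ℝ≥0∞, x ^ ((2 : ℝ≥0) : ℝ) = x ^ 2 := fun x => by norm_num
  simp only [h5, ← h2] at h4
  exact ((ENNReal.pow_right_strictMono two_ne_zero).injective h4).symm

end SimpleIntegral

end ProjectionMeasure

end KatoSmooth

/-! ### Comparison with Lebesgue measure -/

/-- A measure on `ℝ` which is at most `c` times the length on bounded open intervals is at most
`c` times the Lebesgue measure. -/
theorem Real.measure_le_smul_volume_of_Ioo {μ : Measure ℝ} {c : ℝ≥0∞} (hc : c ≠ ∞)
    (h : ∀ a b : ℝ, a < b → μ (Set.Ioo a b) ≤ c * ENNReal.ofReal (b - a)) : μ ≤ c • volume := by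
  have hIoc : ∀ a b : ℝ, μ (Set.Ioc a b) ≤ c * ENNReal.ofReal (b - a) := by
    intro a b
    rcases le_or_gt b a with hab | hab
    · simp [Set.Ioc_eq_empty_of_le hab]
    have ht : Tendsto (fun ε : ℝ => c * ENNReal.ofReal (b + ε - a)) (𝓝[>] 0)
        (𝓝 (c * ENNReal.ofReal (b + 0 - a))) := by
      refine ENNReal.Tendsto.const_mul (ENNReal.tendsto_ofReal ?_) (Or.inr hc)
      have : Continuous fun ε : ℝ => b + ε - a := by fun_prop
      exact this.continuousAt.tendsto.mono_left nhdsWithin_le_nhds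
    rw [add_zero] at ht
    refine ge_of_tendsto ht ?_
    filter_upwards [self_mem_nhdsWithin] with ε hε
    have hε : 0 < ε := hε
    exact (measure_mono (Set.Ioc_subset_Ioo_right (by linarith))).trans
      (h a (b + ε) (by linarith))
  -- The factor `c` can be moved through the infimum defining the outer measure only when it is
  -- nonzero and finite.
  rcases eq_or_ne c 0 with rfl | hc0
  · have hU : (⋃ n : ℕ, Set.Ioc (-(n : ℝ)) n) = Set.univ := by
      refine Set.eq_univ_of_forall fun x => Set.mem_iUnion.2 ?_
      obtain ⟨n, hn⟩ := exists_nat_gt |x|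
      exact ⟨n, (abs_lt.1 hn).1, (abs_lt.1 hn).2.le⟩
    have h0 : μ = 0 := by
      rw [← Measure.measure_univ_eq_zero, ← hU, measure_iUnion_null_iff]
      exact fun n => by simpa using hIoc (-n) n
    simp [h0]
  have hle : μ.toOuterMeasure ≤ c • StieltjesFunction.id.outer := by
    rw [StieltjesFunction.outer, OuterMeasure.smul_ofFunction hc, OuterMeasure.le_ofFunction]
    intro s
    simp only [Pi.smul_apply, smul_eq_mul, StieltjesFunction.length_eq,
      ENNReal.mul_iInf_of_ne hc0 hc]
    refine le_iInf fun a => le_iInf fun b => le_iInf fun hs => ?_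
    refine (measure_mono ?_).trans (hIoc a b)
    intro x hx
    exact hs ⟨hx, fun hb => not_isBot x hb⟩
  refine Measure.le_iff.2 fun s _ => ?_
  have := hle s
  rw [Real.volume_eq_stieltjes_id, StieltjesFunction.measure]
  exact this

/-! ### The truncated operators `G E_H(-R, R)` -/

namespace KatoSmooth

variable {ℋ 𝒦 : Type*} [NormedAddCommGroup ℋ] [InnerProductSpace ℂ ℋ] [CompleteSpace ℋ]
  [NormedAddCommGroup 𝒦] [InnerProductSpace ℂ 𝒦]
  {H : ℋ →ₗ.[ℂ] ℋ} {G : ℋ →ₗ.[ℂ] 𝒦}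

theorem smoothNorm_sq : smoothNorm H G ^ 2 = (smoothConst H G).toReal :=
  Real.sq_sqrt ENNReal.toReal_nonneg

theorem smoothNorm_nonneg : 0 ≤ smoothNorm H G := Real.sqrt_nonneg _

/-- `enormApply` is infinite off the domain, so finiteness of `smoothConst` forces membership as
well as the bound. -/
theorem exists_mem_domain_norm_le_of_norm_le_one (hG : smoothConst H G < ∞) {a b : ℝ} (hab : a < b)
    {u : ℋ} (hu : ‖u‖ ≤ 1) :
    ∃ h : (spectralMeasure H).proj (Set.Ioo a b) u ∈ G.domain,
      ‖G ⟨_, h⟩‖ ≤ smoothNorm H G * √(b - a) := by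
  have h1 : enormApply G ((spectralMeasure H).proj (Set.Ioo a b) u) ≤
      projNorm H G (Set.Ioo a b) := by
    rw [projNorm]
    exact le_iSup₂ (f := fun (u : ℋ) (_ : ‖u‖ ≤ 1) =>
      enormApply G ((spectralMeasure H).proj (Set.Ioo a b) u)) u hu
  have h2 : projNorm H G (Set.Ioo a b) ^ 2 / ENNReal.ofReal (b - a) ≤ smoothConst H G := by
    rw [smoothConst]
    exact le_iSup_of_le a (le_iSup_of_le b (le_iSup_of_le hab le_rfl))
  have hba : 0 < b - a := sub_pos.2 hab
  rw [ENNReal.div_le_iff (by simpa using hba) ENNReal.ofReal_ne_top] at h2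
  have h3 : enormApply G ((spectralMeasure H).proj (Set.Ioo a b) u) ^ 2 ≤
      ENNReal.ofReal ((smoothNorm H G * √(b - a)) ^ 2) := by
    refine (pow_le_pow_left' h1 2).trans (h2.trans_eq ?_)
    rw [mul_pow, Real.sq_sqrt hba.le, smoothNorm_sq, ENNReal.ofReal_mul ENNReal.toReal_nonneg,
      ENNReal.ofReal_toReal hG.ne]
  have hmem : (spectralMeasure H).proj (Set.Ioo a b) u ∈ G.domain := by
    by_contra hn
    simp [enormApply, hn] at h3
  refine ⟨hmem, ?_⟩
  rw [enormApply, dif_pos hmem, ENNReal.ofReal_pow (mul_nonneg smoothNorm_nonneg (Real.sqrt_nonneg _)),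
    ENNReal.pow_le_pow_left_iff two_ne_zero, ← ofReal_norm] at h3
  exact (ENNReal.ofReal_le_ofReal_iff (mul_nonneg smoothNorm_nonneg (Real.sqrt_nonneg _))).1 h3

/-- `G E_H(a, b)` is an everywhere defined bounded operator. -/
theorem exists_mem_domain_norm_le (hG : smoothConst H G < ∞) (a b : ℝ) (u : ℋ) :
    ∃ h : (spectralMeasure H).proj (Set.Ioo a b) u ∈ G.domain,
      ‖G ⟨_, h⟩‖ ≤ smoothNorm H G * √(b - a) * ‖u‖ := by
  rcases le_or_gt b a with hab | hab
  · have h0 : (spectralMeasure H).proj (Set.Ioo a b) u = 0 := by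
      rw [Set.Ioo_eq_empty_of_le hab, ProjectionMeasure.proj_empty, zero_apply]
    refine ⟨h0 ▸ G.domain.zero_mem, ?_⟩
    have : (⟨_, h0 ▸ G.domain.zero_mem⟩ : G.domain) = 0 := Subtype.ext h0
    rw [this, G.map_zero, norm_zero]
    exact mul_nonneg (mul_nonneg smoothNorm_nonneg (Real.sqrt_nonneg _)) (norm_nonneg _)
  rcases eq_or_ne u 0 with rfl | hu
  · refine ⟨by simp, ?_⟩
    have : (⟨(spectralMeasure H).proj (Set.Ioo a b) 0, by simp⟩ : G.domain) = 0 :=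
      Subtype.ext ((spectralMeasure H).proj (Set.Ioo a b)).map_zero
    rw [this, G.map_zero]
    simp
  have hn : ‖u‖ ≠ 0 := norm_ne_zero_iff.2 hu
  have hnC : (‖u‖ : ℂ) ≠ 0 := by exact_mod_cast hn
  obtain ⟨hv, hle⟩ := exists_mem_domain_norm_le_of_norm_le_one hG hab
    (u := ((‖u‖ : ℂ)⁻¹) • u) (by simp [norm_smul, hn])
  have heq : (spectralMeasure H).proj (Set.Ioo a b) u =
      (‖u‖ : ℂ) • (spectralMeasure H).proj (Set.Ioo a b) (((‖u‖ : ℂ)⁻¹) • u) := by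
    rw [map_smul, smul_smul, mul_inv_cancel₀ hnC, one_smul]
  have hmem : (spectralMeasure H).proj (Set.Ioo a b) u ∈ G.domain :=
    heq ▸ G.domain.smul_mem _ hv
  refine ⟨hmem, ?_⟩
  have : (⟨_, hmem⟩ : G.domain) = (‖u‖ : ℂ) • ⟨_, hv⟩ := Subtype.ext heq
  rw [this, G.map_smul, norm_smul, mul_comm]
  simpa using mul_le_mul_of_nonneg_right hle (norm_nonneg u)

/-- The bounded operator `G E_H(-R, R)`. -/
noncomputable def truncOp (hG : smoothConst H G < ∞) (R : ℝ) : ℋ →L[ℂ] 𝒦 :=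
  LinearMap.mkContinuous
    { toFun := fun u => G ⟨_, (exists_mem_domain_norm_le hG (-R) R u).1⟩
      map_add' := fun u v => by
        rw [← G.map_add]
        congr 1
        exact Subtype.ext (map_add _ u v)
      map_smul' := fun c u => by
        rw [RingHom.id_apply, ← G.map_smul]
        congr 1
        exact Subtype.ext (map_smul _ c u) }
    (smoothNorm H G * √(R - -R)) fun u => (exists_mem_domain_norm_le hG (-R) R u).2

theorem truncOp_apply (hG : smoothConst H G < ∞) (R : ℝ) (u : ℋ) :
    truncOp hG R u = G ⟨_, (exists_mem_domain_norm_le hG (-R) R u).1⟩ := rfl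

theorem exists_mem_domain_truncOp_eq (hG : smoothConst H G < ∞) (R : ℝ) {u : ℋ}
    (hu : (spectralMeasure H).proj (Set.Ioo (-R) R) u = u) :
    ∃ h : u ∈ G.domain, truncOp hG R u = G ⟨u, h⟩ := by
  have hm := (exists_mem_domain_norm_le hG (-R) R u).1
  refine ⟨hu ▸ hm, ?_⟩
  rw [truncOp_apply]
  congr 1
  exact Subtype.ext hu

/-- Both sides are `G u`, so the truncation radius is immaterial once it covers the spectral support
of `u`. -/
theorem truncOp_eq_truncOp (hG : smoothConst H G < ∞) {R S : ℝ} {u : ℋ}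
    (hR : (spectralMeasure H).proj (Set.Ioo (-R) R) u = u)
    (hS : (spectralMeasure H).proj (Set.Ioo (-S) S) u = u) :
    truncOp hG R u = truncOp hG S u := by
  obtain ⟨_, h1⟩ := exists_mem_domain_truncOp_eq hG R hR
  obtain ⟨_, h2⟩ := exists_mem_domain_truncOp_eq hG S hS
  rw [h1, h2]

theorem norm_truncOp_proj_Ioo_le (hG : smoothConst H G < ∞) (R a b : ℝ) (u : ℋ) :
    ‖truncOp hG R ((spectralMeasure H).proj (Set.Ioo a b) u)‖ ≤
      smoothNorm H G * √(b - a) * ‖u‖ := by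
  obtain ⟨hm, hle⟩ := exists_mem_domain_norm_le hG (max (-R) a) (min R b) u
  have : truncOp hG R ((spectralMeasure H).proj (Set.Ioo a b) u) = G ⟨_, hm⟩ := by
    rw [truncOp_apply]
    congr 1
    refine Subtype.ext ?_
    change (spectralMeasure H).proj _ _ = _
    rw [ProjectionMeasure.proj_proj _ measurableSet_Ioo measurableSet_Ioo, Set.Ioo_inter_Ioo]
  rw [this]
  refine hle.trans ?_
  have hl : min R b - max (-R) a ≤ b - a := by
    linarith [min_le_right R b, le_max_right (-R) a]
  have := smoothNorm_nonneg (H := H) (G := G)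
  gcongr

variable [CompleteSpace 𝒦]

/-- The scalar spectral measures of the vectors `(G E_H(-R, R))^* v` have bounded densities. -/
theorem scalarMeasure_adjoint_truncOp_le (hG : smoothConst H G < ∞) (R : ℝ) (v : 𝒦) :
    (spectralMeasure H).scalarMeasure ((truncOp hG R).adjoint v) ≤
      ENNReal.ofReal ((smoothNorm H G * ‖v‖) ^ 2) • volume := by
  refine Real.measure_le_smul_volume_of_Ioo ENNReal.ofReal_ne_top fun a b hab => ?_
  rw [ProjectionMeasure.scalarMeasure_apply _ _ measurableSet_Ioo, ← ofReal_norm,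
    ← ENNReal.ofReal_pow (norm_nonneg _), ← ENNReal.ofReal_mul (sq_nonneg _)]
  refine ENNReal.ofReal_le_ofReal ?_
  set P := (spectralMeasure H).proj (Set.Ioo a b)
  have hself : P.adjoint = P :=
    ((spectralMeasure H).isStarProjection _ measurableSet_Ioo).isSelfAdjoint
  have hcomp : P ∘L (truncOp hG R).adjoint = (truncOp hG R ∘L P).adjoint := by
    rw [ContinuousLinearMap.adjoint_comp, hself]
  have hnorm : ‖truncOp hG R ∘L P‖ ≤ smoothNorm H G * √(b - a) :=
    ContinuousLinearMap.opNorm_le_bound _ (mul_nonneg smoothNorm_nonneg (Real.sqrt_nonneg _))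
      fun u => norm_truncOp_proj_Ioo_le hG R a b u
  have h1 : ‖P ((truncOp hG R).adjoint v)‖ ≤ smoothNorm H G * √(b - a) * ‖v‖ := by
    rw [← ContinuousLinearMap.comp_apply, hcomp]
    refine (ContinuousLinearMap.le_opNorm _ _).trans ?_
    rw [LinearIsometryEquiv.norm_map]
    gcongr
  refine (pow_le_pow_left₀ (norm_nonneg _) h1 2).trans_eq ?_
  rw [mul_pow, mul_pow, mul_pow, Real.sq_sqrt (sub_pos.2 hab).le]
  ring

/-- `‖G E_H(-R, R) s(H)‖` is bounded by the norm of `s` in `L²(ℝ)`. -/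
theorem enorm_truncOp_comp_simpleIntegral_le (hG : smoothConst H G < ∞) (R : ℝ)
    (s : SimpleFunc ℝ ℂ) :
    ‖truncOp hG R ∘L (spectralMeasure H).simpleIntegral s‖ₑ ≤
      ENNReal.ofReal (smoothNorm H G) * eLpNorm s 2 volume := by
  -- The adjoint maps `v` to `s̄(H) (G E(-R, R))^* v`. Its norm is the L² norm of `s̄` for a
  -- spectral measure already dominated by Lebesgue measure.
  set T := truncOp hG R ∘L (spectralMeasure H).simpleIntegral s
  have hT : ‖T.adjoint‖ₑ = ‖T‖ₑ := by
    rw [← ofReal_norm, ← ofReal_norm, LinearIsometryEquiv.norm_map]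
  rw [← hT]
  have hv : ∀ v, ‖T.adjoint v‖ₑ ≤ ENNReal.ofReal (smoothNorm H G) * eLpNorm s 2 volume * ‖v‖ₑ := by
    intro v
    have hn : eLpNorm (s.map (starRingEnd ℂ)) 2 (volume : Measure ℝ) = eLpNorm s 2 volume :=
      eLpNorm_congr_norm_ae (ae_of_all _ fun x => by simp)
    rw [ContinuousLinearMap.adjoint_comp, ContinuousLinearMap.comp_apply,
      ProjectionMeasure.adjoint_simpleIntegral, ProjectionMeasure.enorm_simpleIntegral]
    refine (eLpNorm_mono_measure _ (scalarMeasure_adjoint_truncOp_le hG R v)).trans ?_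
    refine (eLpNorm_smul_measure_le _ _ _ _).trans_eq ?_
    rw [hn, smul_eq_mul, mul_right_comm]
    congr 1
    rw [ENNReal.ofReal_rpow_of_nonneg (sq_nonneg _) (by positivity), ← ofReal_norm v,
      ← ENNReal.ofReal_mul smoothNorm_nonneg]
    congr 1
    have h0 : 0 ≤ smoothNorm H G * ‖v‖ := mul_nonneg smoothNorm_nonneg (norm_nonneg _)
    rw [show (1 / (2 : ℝ≥0∞)).toReal = 1 / 2 by simp, ← Real.sqrt_eq_rpow, Real.sqrt_sq h0]
  rcases eq_or_ne (ENNReal.ofReal (smoothNorm H G) * eLpNorm s 2 volume) ∞ with htop | htop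
  · rw [htop]
    exact le_top
  lift ENNReal.ofReal (smoothNorm H G) * eLpNorm s 2 volume to ℝ≥0 using htop with C hC
  refine ENNReal.coe_le_coe.2 (ContinuousLinearMap.opNNNorm_le_bound _ C fun v => ?_)
  exact ENNReal.coe_le_coe.1 (by simpa [← enorm_eq_nnnorm] using hv v)

end KatoSmooth

/-! ### Approximation in L² and the integral `∫ φ dE` -/

theorem cauchySeq_of_edist_le_add {X : Type*} [PseudoEMetricSpace X] {x : ℕ → X} {b : ℕ → ℝ≥0∞}
    (hb : Tendsto b atTop (𝓝 0)) (h : ∀ m n, edist (x m) (x n) ≤ b m + b n) : CauchySeq x := by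
  refine EMetric.cauchySeq_iff.2 fun ε hε => ?_
  have hε2 : 0 < ε / 2 := ENNReal.half_pos hε.ne'
  obtain ⟨N, hN⟩ := eventually_atTop.1 (hb.eventually_lt_const hε2)
  refine ⟨N, fun m hm n hn => (h m n).trans_lt ?_⟩
  exact (ENNReal.add_lt_add (hN m hm) (hN n hn)).trans_eq (ENNReal.add_halves ε)

/-- Square integrable functions on the line are approximated by simple functions with bounded
support. -/
theorem MeasureTheory.MemLp.exists_simpleFunc_bounded_support {φ : ℝ → ℂ} (hφ : MemLp φ 2 volume)
    {ε : ℝ≥0∞} (hε : ε ≠ 0) :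
    ∃ (s : SimpleFunc ℝ ℂ) (R : ℝ), Function.support s ⊆ Set.Ioo (-R) R ∧
      eLpNorm (fun x => φ x - s x) 2 volume ≤ ε := by
  have hε2 : ε / 2 ≠ 0 := (ENNReal.half_pos hε).ne'
  obtain ⟨g, hgc, hg, -, hgm⟩ :=
    hφ.exists_hasCompactSupport_eLpNorm_sub_le ENNReal.ofNat_ne_top hε2
  obtain ⟨t, ht, htm⟩ := hgm.exists_simpleFunc_eLpNorm_sub_lt ENNReal.ofNat_ne_top hε2
  obtain ⟨R, hR⟩ := hgc.isCompact.isBounded.subset_ball (0 : ℝ)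
  rw [Real.ball_eq_Ioo, zero_sub, zero_add] at hR
  refine ⟨t.restrict (Set.Ioo (-R) R), R, ?_, ?_⟩
  · rw [SimpleFunc.coe_restrict _ measurableSet_Ioo]
    exact Set.support_indicator_subset
  have heq : (fun x => φ x - t.restrict (Set.Ioo (-R) R) x) =
      (φ - g) + (Set.Ioo (-R) R).indicator (g - ⇑t) := by
    ext x
    rw [SimpleFunc.coe_restrict _ measurableSet_Ioo]
    by_cases hx : x ∈ Set.Ioo (-R) R
    · simp [hx]
    · have : g x = 0 := by
        by_contra h0
        exact hx (hR (subset_tsupport g h0))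
      simp [hx, this]
  rw [heq]
  refine (eLpNorm_add_le (hφ.1.sub hgm.1)
    ((hgm.1.sub htm.1).indicator measurableSet_Ioo) one_le_two).trans ?_
  refine (add_le_add hg ((MeasureTheory.eLpNorm_indicator_le _).trans ht.le)).trans_eq (ENNReal.add_halves ε)

namespace KatoSmooth

namespace ProjectionMeasure

variable {ℋ : Type*} [NormedAddCommGroup ℋ] [InnerProductSpace ℂ ℋ] [CompleteSpace ℋ]
  (E : ProjectionMeasure ℋ) {φ : ℝ → ℂ} {u w : ℋ}

theorem eLpNorm_simpleFunc_sub_le {μ : Measure ℝ} (hφ : AEStronglyMeasurable φ μ)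
    (s t : SimpleFunc ℝ ℂ) :
    eLpNorm (s - t) 2 μ ≤
      eLpNorm (fun x => φ x - s x) 2 μ + eLpNorm (fun x => φ x - t x) 2 μ := by
  have h : (⇑s - ⇑t : ℝ → ℂ) = (fun x => φ x - t x) - fun x => φ x - s x := by
    ext x
    simp
  rw [SimpleFunc.coe_sub, h, add_comm]
  exact eLpNorm_sub_le (hφ.sub t.aestronglyMeasurable) (hφ.sub s.aestronglyMeasurable) one_le_two

theorem edist_simpleIntegral_le (hφ : AEStronglyMeasurable φ (E.scalarMeasure u))
    (s t : SimpleFunc ℝ ℂ) :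
    edist (E.simpleIntegral s u) (E.simpleIntegral t u) ≤
      eLpNorm (fun x => φ x - s x) 2 (E.scalarMeasure u) +
        eLpNorm (fun x => φ x - t x) 2 (E.scalarMeasure u) := by
  rw [edist_eq_enorm_sub, ← sub_apply, ← E.simpleIntegral_sub,
    E.enorm_simpleIntegral]
  exact eLpNorm_simpleFunc_sub_le hφ s t

/-- One approximating sequence suffices: the images of two such sequences become arbitrarily close
by `edist_simpleIntegral_le`. -/
theorem hasIntegral_of_tendsto (hφ : MemLp φ 2 (E.scalarMeasure u)) {s : ℕ → SimpleFunc ℝ ℂ}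
    (hs : Tendsto (fun n => eLpNorm (fun x => φ x - s n x) 2 (E.scalarMeasure u)) atTop (𝓝 0))
    (hw : Tendsto (fun n => E.simpleIntegral (s n) u) atTop (𝓝 w)) : E.HasIntegral φ u w := by
  refine ⟨hφ, fun t ht => ?_⟩
  rw [tendsto_iff_edist_tendsto_0] at hw ⊢
  refine tendsto_of_tendsto_of_tendsto_of_le_of_le tendsto_const_nhds
    (by simpa using (ht.add hs).add hw) (fun _ => zero_le) fun n => ?_
  exact (edist_triangle _ (E.simpleIntegral (s n) u) _).trans
    (add_le_add_left (E.edist_simpleIntegral_le hφ.1 (t n) (s n)) _)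

/-- `E(A)` commutes with every `s(H)`, hence with the limit. With `A` a bounded interval, this
places `φ(H) u` in the domain of `G`. -/
theorem HasIntegral.proj_eq (h : E.HasIntegral φ u w) {A : Set ℝ} (hA : MeasurableSet A)
    (hu : E.proj A u = u) : E.proj A w = w := by
  -- At `n = 0` the tolerance is `∞`, which is harmless.
  have hex : ∀ n : ℕ, ∃ s : SimpleFunc ℝ ℂ,
      eLpNorm (fun x => φ x - s x) 2 (E.scalarMeasure u) ≤ (n : ℝ≥0∞)⁻¹ := fun n => by
    obtain ⟨s, hs, -⟩ := h.1.exists_simpleFunc_eLpNorm_sub_lt ENNReal.ofNat_ne_top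
      (ENNReal.inv_ne_zero.2 (ENNReal.natCast_ne_top n))
    exact ⟨s, hs.le⟩
  choose s hs using hex
  have hw := h.2 s (tendsto_of_tendsto_of_tendsto_of_le_of_le tendsto_const_nhds
    ENNReal.tendsto_inv_nat_nhds_zero (fun _ => zero_le) hs)
  refine tendsto_nhds_unique (((E.proj A).continuous.tendsto w).comp hw) (hw.congr fun n => ?_)
  rw [Function.comp_apply, E.proj_simpleIntegral_comm hA, hu]

end ProjectionMeasure

/-! ### Existence of `G φ(H)` -/

variable {ℋ 𝒦 : Type*} [NormedAddCommGroup ℋ] [InnerProductSpace ℂ ℋ] [CompleteSpace ℋ]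
  [NormedAddCommGroup 𝒦] [InnerProductSpace ℂ 𝒦]
  {H : ℋ →ₗ.[ℂ] ℋ} {G : ℋ →ₗ.[ℂ] 𝒦} {u : ℋ}

theorem IsLinftyComp.exists_scalarMeasure_le (hu : IsLinftyComp H u) :
    ∃ M : ℝ≥0, (spectralMeasure H).scalarMeasure u ≤ (M : ℝ≥0∞) • volume := by
  obtain ⟨ρ, -, -, ⟨M, hM⟩, h⟩ := hu
  refine ⟨M, ?_⟩
  rw [h, ← withDensity_const]
  exact withDensity_mono (ae_of_all _ fun x => ENNReal.coe_le_coe.2 (hM x))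

theorem IsLinftyComp.exists_proj_eq_self (hu : IsLinftyComp H u) :
    ∃ R : ℝ, (spectralMeasure H).proj (Set.Ioo (-R) R) u = u := by
  obtain ⟨ρ, -, hc, -, h⟩ := hu
  obtain ⟨R, hR⟩ := hc.isCompact.isBounded.subset_ball (0 : ℝ)
  rw [Real.ball_eq_Ioo, zero_sub, zero_add] at hR
  refine ⟨R, ProjectionMeasure.proj_apply_eq_self _ measurableSet_Ioo ?_⟩
  rw [h, withDensity_apply _ measurableSet_Ioo.compl,
    setLIntegral_congr_fun (g := 0) measurableSet_Ioo.compl]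
  · simp
  · intro x hx
    have : ρ x = 0 := by
      by_contra h0
      exact hx (hR (subset_tsupport ρ h0))
    simp [this]

theorem tendsto_eLpNorm_of_le_smul {μ ν : Measure ℝ} {c : ℝ≥0∞} (hc : c ≠ ∞) (h : μ ≤ c • ν)
    {f : ℕ → ℝ → ℂ} (hf : Tendsto (fun n => eLpNorm (f n) 2 ν) atTop (𝓝 0)) :
    Tendsto (fun n => eLpNorm (f n) 2 μ) atTop (𝓝 0) := by
  refine tendsto_of_tendsto_of_tendsto_of_le_of_le tendsto_const_nhds ?_ (fun _ => zero_le)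
    fun n => eLpNorm_le_of_measure_le_smul h
  simp only [smul_eq_mul]
  rw [← mul_zero (c ^ (1 / (2 : ℝ≥0∞)).toReal)]
  exact ENNReal.Tendsto.const_mul hf
    (Or.inr (ENNReal.rpow_ne_top_of_nonneg ENNReal.toReal_nonneg hc))

theorem IsMulFun.tendsto (hG : smoothConst H G < ∞) {φ : ℝ → ℂ} {T : ℋ →L[ℂ] 𝒦}
    (hT : IsMulFun H G φ T) (hu : IsLinftyComp H u) {R : ℝ}
    (hR : (spectralMeasure H).proj (Set.Ioo (-R) R) u = u) {s : ℕ → SimpleFunc ℝ ℂ}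
    (hs : Tendsto (fun n => eLpNorm (fun x => φ x - s n x) 2 volume) atTop (𝓝 0)) :
    Tendsto (fun n => truncOp hG R ((spectralMeasure H).simpleIntegral (s n) u)) atTop
      (𝓝 (T u)) := by
  obtain ⟨w, hw, hTw⟩ := hT.2 u hu
  obtain ⟨M, hM⟩ := hu.exists_scalarMeasure_le
  obtain ⟨_, h⟩ := exists_mem_domain_truncOp_eq hG R (hw.proj_eq _ measurableSet_Ioo hR)
  rw [hTw, ← h]
  exact ((truncOp hG R).continuous.tendsto _).comp
    (hw.2 s (tendsto_eLpNorm_of_le_smul ENNReal.coe_ne_top hM hs))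

variable [CompleteSpace 𝒦]

/-- `‖G E_H(-R, R) E_H(A) u‖² ≤ ‖G‖² |A| ‖E_H(A) u‖²` for Borel sets `A`. -/
theorem norm_truncOp_proj_le (hG : smoothConst H G < ∞) (R : ℝ) {A : Set ℝ} (hA : MeasurableSet A)
    (hAf : volume A ≠ ∞) (u : ℋ) :
    ‖truncOp hG R ((spectralMeasure H).proj A u)‖ ^ 2 ≤
      smoothNorm H G ^ 2 * (volume.real A * ‖(spectralMeasure H).proj A u‖ ^ 2) := by
  set P := (spectralMeasure H).proj A
  set v := truncOp hG R (P u)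
  have h1 : ‖P ((truncOp hG R).adjoint v)‖ ^ 2 ≤ (smoothNorm H G * ‖v‖) ^ 2 * volume.real A := by
    have h := scalarMeasure_adjoint_truncOp_le hG R v A
    rw [ProjectionMeasure.scalarMeasure_apply _ _ hA, ← ofReal_norm,
      ← ENNReal.ofReal_pow (norm_nonneg _), Measure.smul_apply, smul_eq_mul,
      ← ENNReal.ofReal_toReal hAf, ← ENNReal.ofReal_mul (sq_nonneg _)] at h
    exact (ENNReal.ofReal_le_ofReal_iff (by positivity)).1 h
  -- With `B = G E(-R, R)` and `v = B P u`, one has `‖v‖² = ⟪P B^* v, P u⟫`; Cauchy–Schwarz and `h1`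
  -- then bound `‖v‖⁴` by a multiple of `‖v‖²`.
  have h2 : ‖v‖ ^ 2 ≤ ‖P ((truncOp hG R).adjoint v)‖ * ‖P u‖ := by
    have hPP : P (P u) = P u := by
      rw [ProjectionMeasure.proj_proj _ hA hA, Set.inter_self]
    have : ⟪P ((truncOp hG R).adjoint v), P u⟫_ℂ = ⟪v, v⟫_ℂ := by
      rw [ProjectionMeasure.inner_proj_left _ hA, hPP, ContinuousLinearMap.adjoint_inner_left]
    have h3 := norm_inner_le_norm (𝕜 := ℂ) (P ((truncOp hG R).adjoint v)) (P u)
    rwa [this, inner_self_eq_norm_sq_to_K, norm_pow, RCLike.norm_ofReal, abs_norm] at h3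
  rcases eq_or_ne ‖v‖ 0 with hv | hv
  · rw [hv, zero_pow two_ne_zero]
    positivity
  have h4 : ‖v‖ ^ 2 * ‖v‖ ^ 2 ≤ ‖v‖ ^ 2 * (smoothNorm H G ^ 2 * (volume.real A * ‖P u‖ ^ 2)) := by
    calc ‖v‖ ^ 2 * ‖v‖ ^ 2 = (‖v‖ ^ 2) ^ 2 := by ring
      _ ≤ (‖P ((truncOp hG R).adjoint v)‖ * ‖P u‖) ^ 2 := by gcongr
      _ = ‖P ((truncOp hG R).adjoint v)‖ ^ 2 * ‖P u‖ ^ 2 := by ring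
      _ ≤ (smoothNorm H G * ‖v‖) ^ 2 * volume.real A * ‖P u‖ ^ 2 := by gcongr
      _ = _ := by ring
  exact le_of_mul_le_mul_left h4 (by positivity)

/-- A singular vector satisfies `u = E(B) u` for some Lebesgue-null `B`, and `norm_truncOp_proj_le`
gives zero on the range of `E(B)`. -/
theorem truncOp_simpleIntegral_eq_zero_of_isSingularVector (hG : smoothConst H G < ∞) (R : ℝ)
    (hu : IsSingularVector H u) (s : SimpleFunc ℝ ℂ) :
    truncOp hG R ((spectralMeasure H).simpleIntegral s u) = 0 := by
  obtain ⟨A, hA, h0, h1⟩ := hu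
  have hAu := ProjectionMeasure.proj_apply_eq_self (spectralMeasure H) hA.compl (u := u)
    (by rwa [compl_compl])
  have h := norm_truncOp_proj_le hG R hA.compl (by simp [h1])
    ((spectralMeasure H).simpleIntegral s u)
  rw [ProjectionMeasure.proj_simpleIntegral_comm _ hA.compl, hAu, Measure.real, h1] at h
  simpa using h

/-- If `φ ∈ L²(ℝ)` and `G` is Kato smooth, then `G φ(H)` is a well defined bounded operator. -/
theorem exists_isMulFun (hG : smoothConst H G < ∞) {φ : ℝ → ℂ} (hφ : MemLp φ 2 volume) :
    ∃ T : ℋ →L[ℂ] 𝒦, IsMulFun H G φ T := by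
  have hex : ∀ n : ℕ, ∃ (s : SimpleFunc ℝ ℂ) (R : ℝ), Function.support s ⊆ Set.Ioo (-R) R ∧
      eLpNorm (fun x => φ x - s x) 2 volume ≤ (n : ℝ≥0∞)⁻¹ := fun n =>
    hφ.exists_simpleFunc_bounded_support (ENNReal.inv_ne_zero.2 (ENNReal.natCast_ne_top n))
  choose s R hsR hs using hex
  have hs0 : Tendsto (fun n => eLpNorm (fun x => φ x - s n x) 2 volume) atTop (𝓝 0) :=
    tendsto_of_tendsto_of_tendsto_of_le_of_le tendsto_const_nhds
      ENNReal.tendsto_inv_nat_nhds_zero (fun _ => zero_le) hs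
  set E := spectralMeasure H
  have hS : ∀ n S, R n ≤ S → ∀ u, E.proj (Set.Ioo (-S) S) (E.simpleIntegral (s n) u) =
      E.simpleIntegral (s n) u := fun n S hRS u =>
    E.proj_simpleIntegral_of_support_subset measurableSet_Ioo _
      ((hsR n).trans (Set.Ioo_subset_Ioo (neg_le_neg hRS) hRS)) u
  let T : ℕ → ℋ →L[ℂ] 𝒦 := fun n => truncOp hG (R n) ∘L E.simpleIntegral (s n)
  -- Bounded support of `s n` allows any larger truncation radius, so two terms of the sequence can
  -- be compared under a common one.
  have hT : ∀ n S, R n ≤ S → T n = truncOp hG S ∘L E.simpleIntegral (s n) := fun n S hRS => by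
    ext u
    exact truncOp_eq_truncOp hG (hS n _ le_rfl u) (hS n S hRS u)
  have hTc : CauchySeq T := by
    have hb : Tendsto (fun n => ENNReal.ofReal (smoothNorm H G) *
        eLpNorm (fun x => φ x - s n x) 2 volume) atTop (𝓝 0) := by
      simpa using ENNReal.Tendsto.const_mul hs0 (Or.inr ENNReal.ofReal_ne_top)
    refine cauchySeq_of_edist_le_add hb fun m n => ?_
    rw [hT m (max (R m) (R n)) (le_max_left _ _), hT n (max (R m) (R n)) (le_max_right _ _),
      edist_eq_enorm_sub, ← ContinuousLinearMap.comp_sub, ← E.simpleIntegral_sub, ← mul_add]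
    refine (enorm_truncOp_comp_simpleIntegral_le hG _ _).trans ?_
    gcongr
    exact ProjectionMeasure.eLpNorm_simpleFunc_sub_le hφ.1 _ _
  obtain ⟨T', hT'⟩ := cauchySeq_tendsto_of_complete hTc
  have hTu : ∀ u, Tendsto (fun n => T n u) atTop (𝓝 (T' u)) := fun u =>
    ((ContinuousLinearMap.apply ℂ 𝒦 u).continuous.tendsto T').comp hT'
  refine ⟨T', fun u hu => ?_, fun u hu => ?_⟩
  · refine tendsto_nhds_unique (hTu u) (tendsto_const_nhds.congr fun n => ?_)
    exact (truncOp_simpleIntegral_eq_zero_of_isSingularVector hG (R n) hu (s n)).symm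
  obtain ⟨M, hM⟩ := hu.exists_scalarMeasure_le
  obtain ⟨S, hSu⟩ := hu.exists_proj_eq_self
  have hφu := hφ.of_measure_le_smul ENNReal.coe_ne_top hM
  have hsu := tendsto_eLpNorm_of_le_smul ENNReal.coe_ne_top hM hs0
  obtain ⟨w, hw⟩ := cauchySeq_tendsto_of_complete
    (cauchySeq_of_edist_le_add hsu fun m n => E.edist_simpleIntegral_le hφu.1 (s m) (s n))
  have hint := E.hasIntegral_of_tendsto hφu hsu hw
  obtain ⟨hwG, hGw⟩ := exists_mem_domain_truncOp_eq hG S (hint.proj_eq E measurableSet_Ioo hSu)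
  refine ⟨⟨w, hwG⟩, hint, ?_⟩
  rw [← hGw]
  refine tendsto_nhds_unique (hTu u)
    ((((truncOp hG S).continuous.tendsto w).comp hw).congr fun n => ?_)
  refine truncOp_eq_truncOp hG ?_ (hS n _ le_rfl u)
  rw [E.proj_simpleIntegral_comm measurableSet_Ioo, hSu]

theorem isMulFun_mulFun (hG : smoothConst H G < ∞) {φ : ℝ → ℂ} (hφ : MemLp φ 2 volume) :
    IsMulFun H G φ (mulFun H G φ) := by
  have h := exists_isMulFun hG hφ
  rw [mulFun, dif_pos h]
  exact h.choose_spec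

end KatoSmooth

/-! ### Splitting off the singular part -/

namespace KatoSmooth

variable {ℋ 𝒦 : Type*} [NormedAddCommGroup ℋ] [InnerProductSpace ℂ ℋ] [CompleteSpace ℋ]
  [NormedAddCommGroup 𝒦] [InnerProductSpace ℂ 𝒦] {H : ℋ →ₗ.[ℂ] ℋ} {G : ℋ →ₗ.[ℂ] 𝒦} {u : ℋ}

theorem ProjectionMeasure.sum_norm_proj_fiber_sq_le (E : ProjectionMeasure ℋ) {F : Type*}
    (t : SimpleFunc ℝ F) {S : Finset F} (hS : S ⊆ t.range) (u : ℋ) :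
    ∑ b ∈ S, ‖E.proj (t ⁻¹' {b}) u‖ ^ 2 ≤ ‖u‖ ^ 2 := by
  refine (Finset.sum_le_sum_of_subset_of_nonneg hS fun _ _ _ => sq_nonneg _).trans ?_
  rw [← ENNReal.ofReal_le_ofReal_iff (sq_nonneg _),
    ENNReal.ofReal_sum_of_nonneg fun _ _ => sq_nonneg _, ENNReal.ofReal_pow (norm_nonneg _),
    ofReal_norm, ← E.scalarMeasure_univ, ← t.sum_range_measure_preimage_singleton]
  refine Finset.sum_le_sum fun b _ => ?_
  rw [E.scalarMeasure_apply u (t.measurableSet_fiber b), ENNReal.ofReal_pow (norm_nonneg _),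
    ofReal_norm]

/-- Every vector splits into a singular vector and a limit of vectors in `L^∞_comp(H)`. -/
theorem exists_singular_add_tendsto_linftyComp (H : ℋ →ₗ.[ℂ] ℋ) (u : ℋ) :
    ∃ (v : ℋ) (w : ℕ → ℋ), IsSingularVector H v ∧ (∀ k, IsLinftyComp H (w k)) ∧
      (∀ k, ‖w k‖ ≤ ‖u‖) ∧ Tendsto (fun k => v + w k) atTop (𝓝 u) := by
  set E := spectralMeasure H
  set μ := E.scalarMeasure u
  -- `N` has full Lebesgue measure and is null for the singular part of `μ`, so on `N` the measure
  -- `μ` has density `f`. Cutting `N` down to `f ≤ k` and `|x| ≤ k` gives the sets `D k`, which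
  -- exhaust `N` up to a Lebesgue-null set.
  obtain ⟨N, hN, hN1, hN2⟩ := Measure.mutuallySingular_singularPart μ volume
  set f := μ.rnDeriv volume
  have hf : Measurable f := Measure.measurable_rnDeriv _ _
  have hμ : μ.restrict N = (volume.withDensity f).restrict N := by
    conv_lhs => rw [← Measure.singularPart_add_rnDeriv μ volume]
    rw [Measure.restrict_add, Measure.restrict_eq_zero.2 hN1, zero_add]
  let A : ℕ → Set ℝ := fun k => {x | f x ≤ k} ∩ Set.Icc (-(k : ℝ)) k
  let D : ℕ → Set ℝ := fun k => N ∩ A k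
  have hA : ∀ k, MeasurableSet (A k) := fun k =>
    (measurableSet_le hf measurable_const).inter measurableSet_Icc
  have hD : ∀ k, MeasurableSet (D k) := fun k => hN.inter (hA k)
  have hDm : Monotone D := fun i j hij x hx => by
    have hij' : (i : ℝ) ≤ j := by exact_mod_cast hij
    have hij'' : (i : ℝ≥0∞) ≤ j := by exact_mod_cast hij
    refine ⟨hx.1, le_trans hx.2.1 hij'', ?_, hx.2.2.2.trans hij'⟩
    exact (neg_le_neg hij').trans hx.2.2.1
  have hlt : ∀ᵐ x ∂volume, f x < ∞ := Measure.rnDeriv_lt_top _ _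
  have hDU : ∀ x ∈ N, f x < ∞ → x ∈ ⋃ k, D k := fun x hx hfx => by
    obtain ⟨k, hk⟩ := exists_nat_gt (max |x| (f x).toReal)
    have hk1 : |x| ≤ k := (le_max_left _ _).trans hk.le
    refine Set.mem_iUnion.2 ⟨k, hx, ?_, abs_le.1 hk1⟩
    have : (f x).toReal ≤ k := (le_max_right _ _).trans hk.le
    exact (ENNReal.le_ofReal_iff_toReal_le hfx.ne (Nat.cast_nonneg k)).2 this |>.trans
      (by simp)
  have hUm := MeasurableSet.iUnion hD
  refine ⟨E.proj (⋃ k, D k)ᶜ u, fun k => E.proj (D k) u, ?_, fun k => ?_,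
    fun k => E.norm_proj_apply_le (hD k) u, ?_⟩
  · change E.scalarMeasure _ ⟂ₘ volume
    rw [E.scalarMeasure_proj hUm.compl]
    refine ⟨N ∩ {x | f x < ∞}, hN.inter (measurableSet_lt hf measurable_const), ?_, ?_⟩
    · rw [Measure.restrict_apply (hN.inter (measurableSet_lt hf measurable_const))]
      refine measure_mono_null ?_ measure_empty
      rintro x ⟨⟨hx1, hx2⟩, hx⟩
      exact hx (hDU x hx1 hx2)
    · rw [Set.compl_inter]
      exact measure_union_null hN2 hlt
  · have hfin : ∀ x ∈ D k, f x ≤ k := fun x hx => hx.2.1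
    refine ⟨(D k).indicator fun x => (f x).toNNReal,
      hf.ennreal_toNNReal.indicator (hD k), ?_, ⟨k, fun x => ?_⟩, ?_⟩
    · refine HasCompactSupport.intro (isCompact_Icc (a := -(k : ℝ)) (b := k)) fun x hx => ?_
      exact Set.indicator_of_notMem (fun h => hx h.2.2) _
    · by_cases hx : x ∈ D k
      · rw [Set.indicator_of_mem hx]
        exact ENNReal.coe_le_coe.1
          (ENNReal.coe_toNNReal_le_self.trans (by simpa using hfin x hx))
      · rw [Set.indicator_of_notMem hx]
        exact zero_le
    · change E.scalarMeasure (E.proj (D k) u) = _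
      have h1 : (fun x => (((D k).indicator (fun x => (f x).toNNReal) x : ℝ≥0) : ℝ≥0∞)) =
          (D k).indicator f := by
        ext x
        by_cases hx : x ∈ D k
        · simp [hx, ENNReal.coe_toNNReal
            ((hfin x hx).trans_lt (ENNReal.natCast_lt_top k)).ne]
        · simp [hx]
      rw [E.scalarMeasure_proj (hD k), h1, withDensity_indicator (hD k),
        ← restrict_withDensity (hD k)]
      have h2 : ∀ ν : Measure ℝ, ν.restrict (D k) = (ν.restrict N).restrict (D k) := fun ν => by
        rw [Measure.restrict_restrict (hD k), Set.inter_eq_left.2 Set.inter_subset_left]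
      rw [h2, h2 (volume.withDensity f), ← hμ]
  · have h := (E.tendsto_proj_iUnion hD hDm u).const_add (E.proj (⋃ k, D k)ᶜ u)
    rwa [add_comm (E.proj (⋃ k, D k)ᶜ u), E.proj_add_proj_compl hUm] at h

variable [CompleteSpace 𝒦]

/-! ### The Hilbert–Schmidt bound -/

/-- The map `φ ↦ G E_H(-R, R) φ(H) u` averaged over the fibres of a simple function is
Hilbert–Schmidt, with norm at most `‖G‖ ‖u‖`. -/
theorem exists_hilbertSchmidt_average (hG : smoothConst H G < ∞) (R : ℝ) (u : ℋ) {F : Type*}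
    [NormedAddCommGroup F] (t : SimpleFunc ℝ F) (ht : MemLp t 2 (volume : Measure ℝ)) :
    ∃ L : Lp ℂ 2 (volume : Measure ℝ) →ₗ[ℂ] 𝒦,
      (∀ φ, ‖L φ‖ ≤ smoothNorm H G * ‖u‖ * ‖φ‖) ∧
      (∀ (M : ℕ) (ψ : Fin M → Lp ℂ 2 (volume : Measure ℝ)), Orthonormal ℂ ψ →
        ∑ n, ‖L (ψ n)‖ ^ 2 ≤ smoothNorm H G ^ 2 * ‖u‖ ^ 2) ∧
      ∀ g : F → ℂ, g 0 = 0 → ∀ hg : MemLp (t.map g) 2 (volume : Measure ℝ),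
        L hg.toLp = truncOp hG R ((spectralMeasure H).simpleIntegral (t.map g) u) := by
  classical
  set E := spectralMeasure H
  -- The fibre over `0` may have infinite length; it is dropped, and `g 0 = 0` makes this harmless.
  let S : Finset F := t.range.filter (· ≠ 0)
  have hfin : ∀ b ∈ S, volume (t ⁻¹' {b}) ≠ ∞ := fun b hb =>
    (t.measure_preimage_lt_top_of_memLp two_ne_zero ENNReal.ofNat_ne_top ht b
      (Finset.mem_filter.1 hb).2).ne
  let m : F → ℝ := fun b => volume.real (t ⁻¹' {b})
  have hm : ∀ b, 0 ≤ m b := fun b => measureReal_nonneg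
  let z : F → 𝒦 := fun b => truncOp hG R (E.proj (t ⁻¹' {b}) u)
  -- `⟪h b, φ⟫` is the mean of `φ` over the fibre. On a null fibre `(m b)⁻¹ = 0`, so `h b = 0`.
  let h : F → Lp ℂ 2 (volume : Measure ℝ) := fun b =>
    if hb : volume (t ⁻¹' {b}) ≠ ∞ then
      (((m b)⁻¹ : ℝ) : ℂ) • indicatorConstLp 2 (t.measurableSet_fiber b) hb 1 else 0
  have hh : ∀ b (hb : b ∈ S), h b =
      (((m b)⁻¹ : ℝ) : ℂ) • indicatorConstLp 2 (t.measurableSet_fiber b) (hfin b hb) 1 :=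
    fun b hb => dif_pos (hfin b hb)
  have hz : ∀ b ∈ S, ‖z b‖ ^ 2 ≤ smoothNorm H G ^ 2 * (m b * ‖E.proj (t ⁻¹' {b}) u‖ ^ 2) :=
    fun b hb => norm_truncOp_proj_le hG R (t.measurableSet_fiber b) (hfin b hb) u
  have horth : ∀ i ∈ S, ∀ j ∈ S, i ≠ j → ⟪h i, h j⟫_ℂ = 0 := fun i hi j hj hij => by
    rw [hh i hi, hh j hj, inner_smul_left, inner_smul_right,
      L2.inner_indicatorConstLp_one_indicatorConstLp_one _ _ (hfin i hi) (hfin j hj),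
      ((Set.disjoint_singleton.2 hij).preimage t).inter_eq]
    simp
  have hnorm : ∀ b ∈ S, ‖h b‖ ^ 2 * m b ≤ 1 := fun b hb => by
    rw [hh b hb, norm_smul, mul_pow, norm_indicatorConstLp two_ne_zero ENNReal.ofNat_ne_top,
      norm_one, one_mul, ENNReal.toReal_ofNat, ← Real.sqrt_eq_rpow, Real.sq_sqrt (hm b),
      Complex.norm_real, Real.norm_eq_abs, sq_abs]
    rcases eq_or_ne (m b) 0 with h0 | h0
    · simp [h0]
    · exact le_of_eq (by field_simp)
  have hsum : ∑ b ∈ S, ‖h b‖ ^ 2 * ‖z b‖ ^ 2 ≤ smoothNorm H G ^ 2 * ‖u‖ ^ 2 := by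
    calc ∑ b ∈ S, ‖h b‖ ^ 2 * ‖z b‖ ^ 2
        ≤ ∑ b ∈ S, smoothNorm H G ^ 2 * ‖E.proj (t ⁻¹' {b}) u‖ ^ 2 := by
          refine Finset.sum_le_sum fun b hb => ?_
          calc ‖h b‖ ^ 2 * ‖z b‖ ^ 2
              ≤ ‖h b‖ ^ 2 * (smoothNorm H G ^ 2 * (m b * ‖E.proj (t ⁻¹' {b}) u‖ ^ 2)) := by
                gcongr
                exact hz b hb
            _ = (‖h b‖ ^ 2 * m b) * (smoothNorm H G ^ 2 * ‖E.proj (t ⁻¹' {b}) u‖ ^ 2) := by ring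
            _ ≤ 1 * (smoothNorm H G ^ 2 * ‖E.proj (t ⁻¹' {b}) u‖ ^ 2) := by
                gcongr
                exact hnorm b hb
            _ = _ := one_mul _
      _ ≤ smoothNorm H G ^ 2 * ‖u‖ ^ 2 := by
          rw [← Finset.mul_sum]
          gcongr
          exact E.sum_norm_proj_fiber_sq_le t (Finset.filter_subset _ _) u
  let L : Lp ℂ 2 (volume : Measure ℝ) →ₗ[ℂ] 𝒦 :=
    ∑ b ∈ S, ((innerSL ℂ (h b)).smulRight (z b) : Lp ℂ 2 (volume : Measure ℝ) →L[ℂ] 𝒦).toLinearMap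
  have hL : ∀ φ, L φ = ∑ b ∈ S, ⟪h b, φ⟫_ℂ • z b := fun φ => by
    simp [L]
  refine ⟨L, fun φ => ?_, fun M ψ hψ => ?_, fun g hg0 hg => ?_⟩
  · have h0 : 0 ≤ smoothNorm H G * ‖u‖ * ‖φ‖ :=
      mul_nonneg (mul_nonneg smoothNorm_nonneg (norm_nonneg _)) (norm_nonneg _)
    refine (sq_le_sq₀ (norm_nonneg _) h0).1 ?_
    rw [hL, mul_pow, mul_pow]
    exact (norm_sum_inner_smul_sq_le S h horth z φ).trans (by gcongr)
  · simp only [hL]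
    exact (sum_norm_sum_inner_smul_sq_le S h horth z ψ hψ Finset.univ).trans hsum
  · rw [hL, E.simpleIntegral_map t hg0, sum_apply, map_sum,
      ← Finset.sum_filter_add_sum_filter_not t.range (· ≠ 0)]
    rw [Finset.sum_eq_zero (s := t.range.filter fun b => ¬ b ≠ 0), add_zero]
    · refine Finset.sum_congr rfl fun b hb => ?_
      have hint : ∫ x in t ⁻¹' {b}, (hg.toLp : ℝ → ℂ) x = m b • g b := by
        rw [setIntegral_congr_ae (g := fun _ => g b) (t.measurableSet_fiber b),
          setIntegral_const]
        filter_upwards [hg.coeFn_toLp] with x hx hxb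
        rw [hx, SimpleFunc.map_apply, show t x = b from hxb]
      rw [hh b hb, inner_smul_left, L2.inner_indicatorConstLp_one, hint, smul_apply, map_smul]
      change _ = g b • z b
      -- A null fibre has no mean value, but there `z b = 0` by `hz`.
      rcases eq_or_ne (m b) 0 with h0 | h0
      · have : z b = 0 := by simpa [h0] using hz b hb
        rw [this, smul_zero, smul_zero]
      · have h0' : (m b : ℂ) ≠ 0 := by exact_mod_cast h0
        rw [Complex.conj_ofReal, Complex.real_smul, Complex.ofReal_inv,
          inv_mul_cancel_left₀ h0']
    · intro b hb
      rw [not_not.1 (Finset.mem_filter.1 hb).2, hg0, zero_smul, zero_apply, map_zero]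

/-- The Hilbert–Schmidt bound is uniform in the partition, so it survives refinement: `L k (ψ n) → T
n u` for each `n`. -/
theorem sum_norm_sq_le_of_isLinftyComp (hG : smoothConst H G < ∞) {M : ℕ}
    {ψ : Fin M → Lp ℂ 2 (volume : Measure ℝ)} (hψ : Orthonormal ℂ ψ) {T : Fin M → ℋ →L[ℂ] 𝒦}
    (hT : ∀ n, IsMulFun H G (ψ n) (T n)) (hu : IsLinftyComp H u) :
    ∑ n, ‖T n u‖ ^ 2 ≤ smoothNorm H G ^ 2 * ‖u‖ ^ 2 := by
  obtain ⟨R, hR⟩ := hu.exists_proj_eq_self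
  -- Approximating the vector-valued function `Ψ` gives all the `ψ n` one common partition, so that
  -- a single `L k` serves every `n`.
  let Ψ : ℝ → Fin M → ℂ := fun x n => ψ n x
  have hΨ : MemLp Ψ 2 volume := memLp_pi_iff.2 fun n => Lp.memLp (ψ n)
  have hex : ∀ k : ℕ, ∃ t : SimpleFunc ℝ (Fin M → ℂ),
      eLpNorm (Ψ - ⇑t) 2 volume < (k : ℝ≥0∞)⁻¹ ∧ MemLp t 2 volume := fun k =>
    hΨ.exists_simpleFunc_eLpNorm_sub_lt ENNReal.ofNat_ne_top
      (ENNReal.inv_ne_zero.2 (ENNReal.natCast_ne_top k))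
  choose t ht htm using hex
  let s : Fin M → ℕ → SimpleFunc ℝ ℂ := fun n k => (t k).map fun b => b n
  have hsm : ∀ n k, MemLp (s n k) 2 (volume : Measure ℝ) := fun n k => (htm k).eval n
  have hs : ∀ n, Tendsto (fun k => eLpNorm (fun x => ψ n x - s n k x) 2 volume) atTop (𝓝 0) :=
    fun n => tendsto_of_tendsto_of_tendsto_of_le_of_le tendsto_const_nhds
      ENNReal.tendsto_inv_nat_nhds_zero (fun _ => zero_le) fun k =>
        (eLpNorm_mono fun x => norm_le_pi_norm (Ψ x - t k x) n).trans (ht k).le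
  choose L hL1 hL2 hL3 using fun k => exists_hilbertSchmidt_average hG R u (t k) (htm k)
  have hLT : ∀ n, Tendsto (fun k => L k (ψ n)) atTop (𝓝 (T n u)) := fun n => by
    have h1 := (hT n).tendsto hG hu hR (hs n)
    -- `L k` is exact on the simple approximant of `ψ n`; the remainder tends to zero because the
    -- operator norms of the `L k` are bounded uniformly in `k`.
    have h2 : Tendsto (fun k => L k (ψ n - (hsm n k).toLp)) atTop (𝓝 0) := by
      have h3 : ∀ k, ‖ψ n - (hsm n k).toLp‖ =
          (eLpNorm (fun x => ψ n x - s n k x) 2 volume).toReal := fun k => by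
        rw [Lp.norm_def]
        congr 1
        refine eLpNorm_congr_ae ?_
        filter_upwards [Lp.coeFn_sub (ψ n) (hsm n k).toLp, (hsm n k).coeFn_toLp] with x hx1 hx2
        rw [hx1, Pi.sub_apply, hx2]
      refine squeeze_zero_norm (fun k => hL1 k _) ?_
      simp only [h3]
      simpa using ((ENNReal.tendsto_toReal ENNReal.zero_ne_top).comp (hs n)).const_mul
        (smoothNorm H G * ‖u‖)
    have h4 := h1.add h2
    rw [add_zero] at h4
    refine h4.congr fun k => ?_
    rw [map_sub, hL3 k _ rfl (hsm n k), add_sub_cancel]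
  exact le_of_tendsto (tendsto_finsetSum _ fun n _ => (hLT n).norm.pow 2)
    (Eventually.of_forall fun k => hL2 k M ψ hψ)

/-- Finite form of the main inequality. It uses of `E_H` only that it is a projection-valued
measure; self-adjointness of `H` is what makes `E_H` the spectral measure of `H`. -/
theorem sum_norm_sq_le (hG : smoothConst H G < ∞) {M : ℕ}
    {ψ : Fin M → Lp ℂ 2 (volume : Measure ℝ)} (hψ : Orthonormal ℂ ψ) {T : Fin M → ℋ →L[ℂ] 𝒦}
    (hT : ∀ n, IsMulFun H G (ψ n) (T n)) (u : ℋ) :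
    ∑ n, ‖T n u‖ ^ 2 ≤ smoothNorm H G ^ 2 * ‖u‖ ^ 2 := by
  obtain ⟨v, w, hv, hw, hwu, hlim⟩ := exists_singular_add_tendsto_linftyComp H u
  refine le_of_tendsto (tendsto_finsetSum _ fun n _ =>
    ((((T n).continuous.tendsto u).comp hlim).norm.pow 2)) (Eventually.of_forall fun k => ?_)
  -- Every `T n` kills the singular vector `v`, leaving only `w k`.
  simp only [Function.comp_apply, map_add, (hT _).1 v hv, zero_add]
  refine (sum_norm_sq_le_of_isLinftyComp hG hψ hT (hw k)).trans ?_
  gcongr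
  exact hwu k

end KatoSmooth

theorem theorem2p2 {ℋ 𝒦 : Type*}
    [NormedAddCommGroup ℋ] [InnerProductSpace ℂ ℋ] [CompleteSpace ℋ]
    [TopologicalSpace.SeparableSpace ℋ]
    [NormedAddCommGroup 𝒦] [InnerProductSpace ℂ 𝒦] [CompleteSpace 𝒦]
    [TopologicalSpace.SeparableSpace 𝒦]
    (H : ℋ →ₗ.[ℂ] ℋ) (hH : IsSelfAdjoint H)
    (G : ℋ →ₗ.[ℂ] 𝒦) (hG : KatoSmooth.IsKatoSmooth H G)
    (ψ : ℕ → Lp ℂ 2 (volume : Measure ℝ)) (hψ : Orthonormal ℂ ψ) :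
    (∀ n, KatoSmooth.IsMulFun H G (ψ n) (KatoSmooth.mulFun H G (ψ n))) ∧
      ∀ u : ℋ,
        Summable (fun n => ‖KatoSmooth.mulFun H G (ψ n) u‖ ^ 2) ∧
          ∑' n, ‖KatoSmooth.mulFun H G (ψ n) u‖ ^ 2 ≤
            KatoSmooth.smoothNorm H G ^ 2 * ‖u‖ ^ 2 := by
  have hT : ∀ n, KatoSmooth.IsMulFun H G (ψ n) (KatoSmooth.mulFun H G (ψ n)) := fun n =>
    KatoSmooth.isMulFun_mulFun hG.2 (Lp.memLp (ψ n))
  refine ⟨hT, fun u => ?_⟩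
  have hle : ∀ M : ℕ, ∑ n ∈ Finset.range M, ‖KatoSmooth.mulFun H G (ψ n) u‖ ^ 2 ≤
      KatoSmooth.smoothNorm H G ^ 2 * ‖u‖ ^ 2 := fun M => by
    rw [Finset.sum_range]
    exact KatoSmooth.sum_norm_sq_le hG.2 (hψ.comp (fun n : Fin M => (n : ℕ)) Fin.val_injective)
      (fun n => hT n) u
  exact ⟨summable_of_sum_range_le (fun _ => sq_nonneg _) hle,
    Real.tsum_le_of_sum_range_le (fun _ => sq_nonneg _) hle⟩
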